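/- Let $\tau$ be the difference expression acting on complex sequences $u=(u_n)_{n\ge 0}$ by $$(\tau u)_0=u_0+u_1,\qquad (\tau u)_n=n\,u_{n-1}+(2n+1)\,u_n+(n+1)\,u_{n+1}\quad(n\ge 1),$$ and let $H_0$ be the discrete Laguerre operator in $\ell^2(\mathbb N_0)$, that is, $H_0u=\tau u$ on the maximal domain $\{u\in\ell^2(\mathbb N_0):\tau u\in\ell^2(\mathbb N_0)\}$. Then there is exactly one strongly continuous one-parameter group of unitary operators $U(t)=\mathrm e^{-\mathrm i tH_0}$, $t\in\mathbb R$, on $\ell^2(\mathbb N_0)$ generated by $H_0$, in the sense that $\lim_{t\to 0}\frac{\mathrm i}{t}\,(U(t)u-u)$ exists in $\ell^2(\mathbb N_0)$ if and only if $u$ lies in the domain of $H_0$, and then equals $H_0u$. For every $t\in\mathbb R$, the norm of $\mathrm e^{-\mathrm i tH_0}$ as an operator from $\ell^1(\mathbb N_0)\subset\ell^2(\mathbb N_0)$ to $\ell^\infty(\mathbb N_0)\supset\ell^2(\mathbb N_0)$ is $$\big\|\mathrm e^{-\mathrm i tH_0}\big\|_{\ell^1\to\ell^\infty}=\frac{1}{\sqrt{1+t^2}}.$$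 -/

import Mathlib

open scoped ENNReal

/-- The space `ℓ^p(ℕ₀)` of complex sequences, with its usual norm. -/
abbrev SeqLp (p : ℝ≥0∞) : Type := lp (fun _ : ℕ => ℂ) p

/-- The Laguerre difference expression `τ`, acting on arbitrary complex sequences. -/
def laguerreTau : (ℕ → ℂ) →ₗ[ℂ] (ℕ → ℂ) where
  toFun u n :=
    match n with
    | 0 => u 0 + u 1
    | k + 1 => ((k : ℂ) + 1) * u k + (2 * ((k : ℂ) + 1) + 1) * u (k + 1)
        + ((k : ℂ) + 2) * u (k + 2)
  map_add' u v := by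
    funext n
    cases n <;> simp only [Pi.add_apply] <;> ring
  map_smul' c u := by
    funext n
    cases n <;> simp only [Pi.smul_apply, smul_eq_mul, RingHom.id_apply] <;> ring

/-- The discrete Laguerre operator `H₀` in `ℓ²(ℕ₀)`: it acts by `τ` on its maximal domain
`{u ∈ ℓ² : τ u ∈ ℓ²}`. -/
def laguerreOperator : SeqLp 2 →ₗ.[ℂ] SeqLp 2 where
  domain :=
    { carrier := {u | Memℓp (laguerreTau (u : ℕ → ℂ)) 2}
      add_mem' := fun {u v} hu hv => by
        have h : Memℓp (laguerreTau (u : ℕ → ℂ) + laguerreTau (v : ℕ → ℂ)) 2 :=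
          Memℓp.add hu hv
        rw [← map_add] at h
        exact h
      zero_mem' := by
        have h : Memℓp (0 : ℕ → ℂ) 2 := zero_memℓp
        rw [← map_zero laguerreTau] at h
        exact h
      smul_mem' := fun c u hu => by
        have h : Memℓp (c • laguerreTau (u : ℕ → ℂ)) 2 := Memℓp.const_smul hu c
        rw [← map_smul] at h
        exact h }
  toFun :=
    { toFun := fun u => ⟨laguerreTau ((u : SeqLp 2) : ℕ → ℂ), u.2⟩
      map_add' := fun u v => Subtype.ext (laguerreTau.map_add _ _)
      map_smul' := fun c u => Subtype.ext (laguerreTau.map_smul c _) }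

/-- `U` is the evolution group `t ↦ exp(-itA)` of the (unbounded) operator `A` in the sense of
Stone's theorem: a strongly continuous one-parameter group of unitary operators whose
infinitesimal generator is `-iA`. The last field says that the limit
`lim_{t → 0} i (U(t) u - u) / t` exists precisely for `u` in the domain of `A`, and that it is
then equal to `A u`. -/
structure IsEvolutionGroup {E : Type*} [NormedAddCommGroup E] [InnerProductSpace ℂ E]
    [CompleteSpace E] (A : E →ₗ.[ℂ] E) (U : ℝ → E →L[ℂ] E) : Prop where
  unitary : ∀ t, U t ∈ unitary (E →L[ℂ] E)
  map_zero : U 0 = 1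
  map_add : ∀ s t, U (s + t) = U s * U t
  continuous : ∀ u, Continuous fun t => U t u
  generator : ∀ u f : E,
    Filter.Tendsto (fun t : ℝ => (Complex.I / (t : ℂ)) • (U t u - u)) (nhdsWithin 0 {0}ᶜ) (nhds f)
      ↔ ∃ hu : u ∈ A.domain, A ⟨u, hu⟩ = f

/-- The inclusion `ℓ¹ ⊆ ℓ²` as a bounded operator. -/
noncomputable def inclOneTwo : SeqLp 1 →L[ℂ] SeqLp 2 :=
  (lp.linearMapOfLE ℂ (fun _ : ℕ => ℂ) (p := 1) (q := 2) one_le_two).mkContinuous 1 (by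
    intro u
    rw [one_mul]
    refine lp.norm_le_of_forall_sum_le (by norm_num) (norm_nonneg u) fun s => ?_
    have h1 : ∑ i ∈ s, ‖u i‖ ≤ ‖u‖ := by
      simpa using lp.sum_rpow_le_norm_rpow (p := 1) (by norm_num) u s
    have h2 : ∀ i, ‖u i‖ ≤ ‖u‖ := lp.norm_apply_le_norm one_ne_zero u
    simp only [lp.coe_linearMapOfLE_apply, ENNReal.toReal_ofNat, Real.rpow_two]
    calc ∑ i ∈ s, ‖u i‖ ^ 2 ≤ ∑ i ∈ s, ‖u‖ * ‖u i‖ :=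
          Finset.sum_le_sum fun i _ => by nlinarith [h2 i, norm_nonneg (u i)]
      _ = ‖u‖ * ∑ i ∈ s, ‖u i‖ := (Finset.mul_sum _ _ _).symm
      _ ≤ ‖u‖ ^ 2 := by nlinarith [norm_nonneg u])

/-- The inclusion `ℓ² ⊆ ℓ^∞` as a bounded operator. -/
noncomputable def inclTwoInfty : SeqLp 2 →L[ℂ] SeqLp ∞ :=
  (lp.linearMapOfLE ℂ (fun _ : ℕ => ℂ) (p := 2) (q := ∞) le_top).mkContinuous 1 (by
    intro u
    rw [one_mul]
    exact lp.norm_le_of_forall_le (norm_nonneg u)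
      (fun n => lp.norm_apply_le_norm two_ne_zero u n))

/-- A bounded operator on `ℓ²`, regarded as an operator from `ℓ¹` to `ℓ^∞`. Its norm in
`SeqLp 1 →L[ℂ] SeqLp ∞` is the operator norm `ℓ¹ → ℓ^∞`. -/
noncomputable def asOneInfty (B : SeqLp 2 →L[ℂ] SeqLp 2) : SeqLp 1 →L[ℂ] SeqLp ∞ :=
  inclTwoInfty.comp (B.comp inclOneTwo)

/-! The group is built from an explicit kernel, a polynomial in `b = 1 / (1 + it)`. It is symmetric,
and so is `τ` applied to either of its variables; since `b' = -i b ^ 2`, it solves the Schrödinger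
equation entrywise (`laguerreKernel.hasDerivAt_param`).

A doubly indexed array on which `τ` acts alike in both variables is determined by its column `0`.
Comparing columns by a generating function gives the group law (`laguerreKernel.tsum_mul`), hence
orthonormal rows and a unitary group.

Kernel rows decay geometrically up to polynomial factors, so `τ` can be moved from any bounded
sequence onto the kernel. This identifies the generator with `τ` on its maximal domain, without a
separate proof of self-adjointness. Uniqueness follows from density of the domain and a constant
inner product.

The `ℓ¹ → ℓ^∞` norm is governed by the entries of the kernel. Each entry is `b` times a diagonal
coefficient of a symmetric power of a unitary `2 × 2` matrix, so it is at most `|b|` in modulus; the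
`(0, 0)` entry is `b`. -/

theorem HasSum.of_forall_eq {f g : ℕ → ℂ} {a : ℂ} (hg : HasSum g a) (h : ∀ k, f k = g k) :
    HasSum f a := by
  rwa [funext h]

/-- At `n = 0` the truncated index `n - 1` is harmless, because its coefficient vanishes. -/
theorem laguerreTau_apply (u : ℕ → ℂ) (n : ℕ) :
    laguerreTau u n = n * u (n - 1) + (2 * n + 1) * u n + (n + 1) * u (n + 1) := by
  cases n with
  | zero => simp [laguerreTau]
  | succ k =>
    simp only [laguerreTau, LinearMap.coe_mk, AddHom.coe_mk, Nat.add_sub_cancel]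
    push_cast
    ring

/-! ### The action of `τ` on binomial-geometric sequences. -/

/-- The coefficients `C(n, j) a ^ (n - j)` of `X ^ j / (1 - a X) ^ (j + 1)`. -/
noncomputable def chooseGeom (a : ℂ) (j n : ℕ) : ℂ := n.choose j * a ^ (n - j)

namespace chooseGeom

theorem eq_zero_of_lt (a : ℂ) {j n : ℕ} (h : n < j) : chooseGeom a j n = 0 := by
  simp [chooseGeom, Nat.choose_eq_zero_of_lt h]

theorem zero_left (a : ℂ) (n : ℕ) : chooseGeom a 0 n = a ^ n := by
  simp [chooseGeom]

theorem succ_mul (a : ℂ) (j n : ℕ) :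
    (n + 1) * chooseGeom a j n = (j + 1) * chooseGeom a (j + 1) (n + 1) := by
  have h : ((n : ℂ) + 1) * n.choose j = (n + 1).choose (j + 1) * (j + 1) := by
    exact_mod_cast Nat.add_one_mul_choose_eq n j
  simp only [chooseGeom, Nat.add_sub_add_right]
  linear_combination a ^ (n - j) * h

theorem index_mul (a : ℂ) (j n : ℕ) :
    n * chooseGeom a j n = j * chooseGeom a j n + (j + 1) * a * chooseGeom a (j + 1) n := by
  rcases lt_trichotomy n j with h | rfl | h
  · rw [eq_zero_of_lt a h, eq_zero_of_lt a (h.trans j.lt_succ_self)]; simp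
  · rw [eq_zero_of_lt a n.lt_succ_self]; simp
  · obtain ⟨d, rfl⟩ := Nat.exists_eq_add_of_lt h
    have h1 : ((j + d + 1).choose (j + 1) : ℂ) * (j + 1) = (j + d + 1).choose j * (d + 1) := by
      have := Nat.choose_succ_right_eq (j + d + 1) j
      rw [show j + d + 1 - j = d + 1 by omega] at this
      exact_mod_cast this
    simp only [chooseGeom, show j + d + 1 - j = d + 1 by omega,
      show j + d + 1 - (j + 1) = d by omega]
    push_cast
    linear_combination (-a ^ (d + 1)) * h1

theorem succ_succ (a : ℂ) (j n : ℕ) :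
    chooseGeom a (j + 1) (n + 1) = chooseGeom a j n + a * chooseGeom a (j + 1) n := by
  rcases le_or_gt n j with h | h
  · rw [eq_zero_of_lt a (Nat.lt_succ_of_le h)]
    rcases h.lt_or_eq with h | rfl
    · rw [eq_zero_of_lt a h, eq_zero_of_lt a (Nat.succ_lt_succ h)]; simp
    · simp [chooseGeom]
  · obtain ⟨d, rfl⟩ := Nat.exists_eq_add_of_lt h
    simp only [chooseGeom, show j + d + 1 - j = d + 1 by omega, Nat.add_sub_add_right,
      show j + d + 1 - (j + 1) = d by omega, Nat.choose_succ_succ (j + d + 1) j]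
    push_cast
    ring

/-- On generating functions `τ` is `f ↦ (1 + z) ^ 2 f' + (1 + z) f`, which keeps the span of this
family in `j` invariant. For `a = b - 1` the factors `1 + a` become powers of `b`. -/
theorem laguerreTau_eq (a : ℂ) (j n : ℕ) :
    laguerreTau (chooseGeom a j) n =
      (j + 1) * (1 + a) ^ 2 * chooseGeom a (j + 1) n + (2 * j + 1) * (1 + a) * chooseGeom a j n
        + j * chooseGeom a (j - 1) n := by
  have h1 : (n : ℂ) * chooseGeom a j (n - 1) = (j + 1) * chooseGeom a (j + 1) n := by
    cases n with
    | zero => simp [chooseGeom]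
    | succ k => simpa using succ_mul a j k
  have h2 := index_mul a j n
  have h3 : ((n : ℂ) + 1) * chooseGeom a j (n + 1) = (2 * j + 1) * a * chooseGeom a j n
      + (j + 1) * a ^ 2 * chooseGeom a (j + 1) n + j * chooseGeom a (j - 1) n := by
    cases j with
    | zero =>
      have h4 : chooseGeom a 0 (n + 1) = a * chooseGeom a 0 n := by
        simp only [zero_left]; ring
      rw [h4]
      push_cast at h2 ⊢
      linear_combination a * h2
    | succ i =>
      have h4 := index_mul a i n
      rw [succ_succ]
      simp only [Nat.add_sub_cancel]
      push_cast at h2 ⊢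
      linear_combination a * h2 + h4
  rw [laguerreTau_apply]
  linear_combination h1 + 2 * h2 + h3

theorem hasDerivAt (b : ℂ) (j n : ℕ) :
    HasDerivAt (fun b => chooseGeom (b - 1) j n) ((j + 1) * chooseGeom (b - 1) (j + 1) n) b := by
  have h := (((hasDerivAt_id b).sub_const 1).pow (n - j)).const_mul (n.choose j : ℂ)
  refine h.congr_deriv ?_
  rcases le_or_gt j n with hj | hj
  · have h1 : (n.choose (j + 1) : ℂ) * (j + 1) = n.choose j * (n - j : ℕ) := by
      exact_mod_cast Nat.choose_succ_right_eq n j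
    simp only [chooseGeom, id, Nat.sub_sub]
    linear_combination (-(b - 1) ^ (n - (j + 1))) * h1
  · simp [chooseGeom, Nat.choose_eq_zero_of_lt hj, Nat.choose_eq_zero_of_lt (hj.trans j.lt_succ_self)]

theorem hasSum_mul_pow {a c : ℂ} (h : ‖a * c‖ < 1) (j : ℕ) :
    HasSum (fun k => chooseGeom a j k * c ^ k) (c ^ j / (1 - a * c) ^ (j + 1)) := by
  have h1 := (hasSum_choose_mul_geometric_of_norm_lt_one j h).mul_left (c ^ j)
  rw [← hasSum_nat_add_iff' j, Finset.sum_eq_zero, sub_zero]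
  · rw [div_eq_mul_one_div]
    refine h1.of_forall_eq fun k => ?_
    simp only [chooseGeom, Nat.add_sub_cancel]
    ring
  · intro k hk
    rw [eq_zero_of_lt a (Finset.mem_range.1 hk), zero_mul]

theorem summable_norm {a : ℂ} (h : ‖a‖ < 1) (j : ℕ) : Summable fun k => ‖chooseGeom a j k‖ := by
  rw [← summable_nat_add_iff j]
  have h1 := summable_choose_mul_geometric_of_norm_lt_one j (r := ‖a‖) (by simpa using h)
  refine h1.congr fun k => ?_
  simp [chooseGeom]

theorem summable_weighted_norm {a : ℂ} (h : ‖a‖ < 1) (j : ℕ) :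
    Summable fun k : ℕ => (k + 1) * ‖chooseGeom a j k‖ := by
  have h1 := ((summable_norm h j).mul_left ((j : ℝ) + 1)).add
    ((summable_norm h (j + 1)).mul_left (((j : ℝ) + 1) * ‖a‖))
  refine Summable.of_nonneg_of_le (fun k => by positivity) (fun k => ?_) h1
  have h2 := congrArg norm (index_mul a j k)
  have h3 := norm_add_le (j * chooseGeom a j k) ((j + 1) * a * chooseGeom a (j + 1) k)
  rw [← h2] at h3
  have h4 : ‖(j : ℂ) + 1‖ = j + 1 := by
    exact_mod_cast Complex.norm_natCast (j + 1)
  simp only [norm_mul, Complex.norm_natCast, h4] at h3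
  linarith

end chooseGeom

/-! ### The kernel: symmetry, derivative in `b`, decay, generating function. -/

/-- The kernel of `exp(-itH₀)` as a polynomial in `b = 1 / (1 + it)`. -/
noncomputable def laguerreKernel (b : ℂ) (n m : ℕ) : ℂ :=
  ∑ j ∈ Finset.range (n + 1), b ^ (2 * j + 1) * chooseGeom (b - 1) j n * chooseGeom (b - 1) j m

namespace laguerreKernel

theorem eq_sum (b : ℂ) {n m N : ℕ} (h : n < N) :
    laguerreKernel b n m =
      ∑ j ∈ Finset.range N, b ^ (2 * j + 1) * chooseGeom (b - 1) j n * chooseGeom (b - 1) j m := by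
  refine Finset.sum_subset (Finset.range_mono h) fun j _ hj => ?_
  rw [chooseGeom.eq_zero_of_lt _ (show n < j by simpa using hj)]
  ring

theorem symm (b : ℂ) (n m : ℕ) : laguerreKernel b n m = laguerreKernel b m n := by
  rw [eq_sum b (N := n + m + 1) (by omega), eq_sum b (n := m) (N := n + m + 1) (by omega)]
  exact Finset.sum_congr rfl fun j _ => by ring

theorem zero_left (b : ℂ) (m : ℕ) : laguerreKernel b 0 m = b * (b - 1) ^ m := by
  simp [laguerreKernel, chooseGeom]

theorem one (n m : ℕ) : laguerreKernel 1 n m = if n = m then 1 else 0 := by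
  have h : ∀ j k : ℕ, chooseGeom 0 j k = if k = j then 1 else 0 := fun j k => by
    rcases lt_trichotomy k j with h | rfl | h
    · rw [chooseGeom.eq_zero_of_lt _ h, if_neg h.ne]
    · simp [chooseGeom]
    · simp [chooseGeom, h.ne', (Nat.sub_pos_of_lt h).ne']
  simp only [laguerreKernel, h, sub_self, one_pow, mul_ite, mul_one, mul_zero]
  rw [Finset.sum_eq_single n (fun j _ hj => by simp [hj.symm]) (by simp)]
  simp [eq_comm]

theorem conj (b : ℂ) (n m : ℕ) :
    (starRingEnd ℂ) (laguerreKernel b n m) = laguerreKernel ((starRingEnd ℂ) b) n m := by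
  simp [laguerreKernel, chooseGeom]

/-- The symmetric expression for `τ` applied to either variable of the kernel. -/
theorem laguerreTau_eq_sum (b : ℂ) (n m N : ℕ) (hm : m < N) :
    laguerreTau (fun k => laguerreKernel b k m) n =
      ∑ j ∈ Finset.range N, ((2 * j + 1) * b ^ (2 * j + 2) * chooseGeom (b - 1) j n *
          chooseGeom (b - 1) j m
        + (j + 1) * b ^ (2 * j + 3) * (chooseGeom (b - 1) (j + 1) n * chooseGeom (b - 1) j m
          + chooseGeom (b - 1) j n * chooseGeom (b - 1) (j + 1) m)) := by
  have h0 : laguerreTau (fun k => laguerreKernel b k m) n =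
      ∑ j ∈ Finset.range (N + 1), b ^ (2 * j + 1) * chooseGeom (b - 1) j m *
        laguerreTau (chooseGeom (b - 1) j) n := by
    have h : ∀ k, laguerreKernel b k m = ∑ j ∈ Finset.range (N + 1),
        b ^ (2 * j + 1) * chooseGeom (b - 1) j k * chooseGeom (b - 1) j m := fun k => by
      rw [symm, eq_sum b (n := m) (N := N + 1) (by omega)]
      exact Finset.sum_congr rfl fun j _ => by ring
    simp only [laguerreTau_apply, h, Finset.mul_sum, ← Finset.sum_add_distrib]
    exact Finset.sum_congr rfl fun j _ => by ring
  -- The lowering term vanishes at `j = 0`, so shifting `j` turns `range (N + 1)` into `range N`; in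
  -- `h2` the term `j = N` vanishes since `m < N`.
  have h1 : ∑ j ∈ Finset.range (N + 1), b ^ (2 * j + 1) * chooseGeom (b - 1) j m *
      (j * chooseGeom (b - 1) (j - 1) n) = ∑ j ∈ Finset.range N, (j + 1) * b ^ (2 * j + 3) *
        (chooseGeom (b - 1) j n * chooseGeom (b - 1) (j + 1) m) := by
    rw [Finset.sum_range_succ']
    simp only [Nat.cast_zero, zero_mul, mul_zero, add_zero, Nat.add_sub_cancel]
    exact Finset.sum_congr rfl fun j _ => by push_cast; ring
  have h2 : ∑ j ∈ Finset.range (N + 1), b ^ (2 * j + 1) * chooseGeom (b - 1) j m *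
      ((j + 1) * b ^ 2 * chooseGeom (b - 1) (j + 1) n + (2 * j + 1) * b * chooseGeom (b - 1) j n)
      = ∑ j ∈ Finset.range N, ((2 * j + 1) * b ^ (2 * j + 2) * chooseGeom (b - 1) j n *
          chooseGeom (b - 1) j m
        + (j + 1) * b ^ (2 * j + 3) *
          (chooseGeom (b - 1) (j + 1) n * chooseGeom (b - 1) j m)) := by
    rw [Finset.sum_range_succ, chooseGeom.eq_zero_of_lt _ hm]
    simp only [mul_zero, zero_mul, add_zero]
    exact Finset.sum_congr rfl fun j _ => by ring
  simp only [h0, chooseGeom.laguerreTau_eq, add_sub_cancel, mul_add (_ * _) (_ + _)]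
  rw [Finset.sum_add_distrib, h1, h2, ← Finset.sum_add_distrib]
  exact Finset.sum_congr rfl fun j _ => by ring

theorem laguerreTau_symm (b : ℂ) (n m : ℕ) :
    laguerreTau (laguerreKernel b n) m = laguerreTau (fun k => laguerreKernel b k m) n := by
  have h : laguerreKernel b n = fun k => laguerreKernel b k n := funext fun k => symm b n k
  rw [h, laguerreTau_eq_sum b n m (n + m + 1) (by omega),
    laguerreTau_eq_sum b m n (n + m + 1) (by omega)]
  exact Finset.sum_congr rfl fun j _ => by ring

theorem hasDerivAt (b : ℂ) (n m : ℕ) :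
    ∃ d, HasDerivAt (fun b => laguerreKernel b n m) d b ∧
      b ^ 2 * d = laguerreTau (laguerreKernel b n) m := by
  rw [laguerreTau_symm, laguerreTau_eq_sum b n m (n + m + 1) (by omega)]
  simp only [eq_sum _ (show n < n + m + 1 by omega)]
  refine ⟨_, HasDerivAt.fun_sum fun j _ => ((hasDerivAt_pow (2 * j + 1) b).fun_mul
    (chooseGeom.hasDerivAt b j n)).fun_mul (chooseGeom.hasDerivAt b j m), ?_⟩
  rw [Finset.mul_sum]
  refine Finset.sum_congr rfl fun j _ => ?_
  simp only [Nat.add_sub_cancel]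
  push_cast
  ring

theorem summable_weighted_norm {b : ℂ} (h : ‖b - 1‖ < 1) (n : ℕ) :
    Summable fun k : ℕ => (k + 1) * ‖laguerreKernel b n k‖ := by
  have h1 : Summable fun k : ℕ => ∑ j ∈ Finset.range (n + 1),
      ‖b ^ (2 * j + 1) * chooseGeom (b - 1) j n‖ * ((k + 1) * ‖chooseGeom (b - 1) j k‖) :=
    summable_sum fun j _ => (chooseGeom.summable_weighted_norm h j).mul_left _
  refine Summable.of_nonneg_of_le (fun k => by positivity) (fun k => ?_) h1
  refine (mul_le_mul_of_nonneg_left (norm_sum_le _ _) (by positivity)).trans_eq ?_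
  rw [Finset.mul_sum]
  refine Finset.sum_congr rfl fun j _ => ?_
  rw [norm_mul]
  ring

theorem hasSum_mul_pow {b c : ℂ} (h : ‖(b - 1) * c‖ < 1) (n : ℕ) :
    HasSum (fun k => laguerreKernel b n k * c ^ k)
      (b / (1 - (b - 1) * c) * (b - 1 + b ^ 2 * c / (1 - (b - 1) * c)) ^ n) := by
  have h1 : HasSum (fun k => ∑ j ∈ Finset.range (n + 1),
      b ^ (2 * j + 1) * chooseGeom (b - 1) j n * (chooseGeom (b - 1) j k * c ^ k))
      (∑ j ∈ Finset.range (n + 1), b ^ (2 * j + 1) * chooseGeom (b - 1) j n *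
        (c ^ j / (1 - (b - 1) * c) ^ (j + 1))) :=
    hasSum_sum fun j _ => (chooseGeom.hasSum_mul_pow h j).mul_left _
  convert h1 using 1
  · funext k
    rw [laguerreKernel, Finset.sum_mul]
    exact Finset.sum_congr rfl fun j _ => by ring
  · rw [add_comm (b - 1), add_pow, Finset.mul_sum]
    refine Finset.sum_congr rfl fun j _ => ?_
    rw [chooseGeom, div_pow, mul_pow]
    generalize 1 - (b - 1) * c = d
    ring

end laguerreKernel

/-! ### Summation by parts. -/

/-- `τ` is symmetric for the bilinear pairing of rapidly decaying and bounded sequences. -/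
theorem tsum_laguerreTau_mul {v w : ℕ → ℂ} (hv : Summable fun k : ℕ => (k + 1) * ‖v k‖) {C : ℝ}
    (hw : ∀ k, ‖w k‖ ≤ C) :
    ∑' k, laguerreTau v k * w k = ∑' k, v k * laguerreTau w k := by
  have key : ∀ g : ℕ → ℂ, (∀ k : ℕ, ‖g k‖ ≤ 2 * C * (k + 1)) → Summable fun k => v k * g k := by
    intro g hg
    refine Summable.of_norm_bounded (hv.mul_left (2 * C)) fun k => ?_
    rw [norm_mul]
    nlinarith [hg k, norm_nonneg (v k)]
  have hC : 0 ≤ C := (norm_nonneg _).trans (hw 0)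
  have e1 : ∀ k : ℕ, ‖(k : ℂ) + 1‖ = k + 1 := fun k => by
    exact_mod_cast Complex.norm_natCast (k + 1)
  have e2 : ∀ k : ℕ, ‖2 * (k : ℂ) + 1‖ = 2 * k + 1 := fun k => by
    exact_mod_cast Complex.norm_natCast (2 * k + 1)
  have s1 : Summable fun k : ℕ => v k * ((k + 1) * w (k + 1)) := key _ fun k => by
    rw [norm_mul, e1]
    nlinarith [hw (k + 1), (Nat.cast_nonneg k : (0 : ℝ) ≤ k)]
  have s2 : Summable fun k : ℕ => v k * ((2 * k + 1) * w k) := key _ fun k => by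
    rw [norm_mul, e2]
    nlinarith [hw k, (Nat.cast_nonneg k : (0 : ℝ) ≤ k)]
  have s3 : Summable fun k : ℕ => v k * (k * w (k - 1)) := key _ fun k => by
    rw [norm_mul, Complex.norm_natCast]
    nlinarith [hw (k - 1), (Nat.cast_nonneg k : (0 : ℝ) ≤ k)]
  have h1 : HasSum (fun k : ℕ => k * v (k - 1) * w k) (∑' k : ℕ, v k * ((k + 1) * w (k + 1))) := by
    rw [← hasSum_nat_add_iff' 1]
    rw [Finset.sum_range_one, Nat.cast_zero, zero_mul, zero_mul, sub_zero]
    refine s1.hasSum.of_forall_eq fun k => ?_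
    simp only [Nat.add_sub_cancel]
    push_cast
    ring
  have h3 : HasSum (fun k : ℕ => (k + 1) * v (k + 1) * w k) (∑' k : ℕ, v k * (k * w (k - 1))) := by
    have := s3.hasSum
    rw [← hasSum_nat_add_iff' 1, Finset.sum_range_one, Nat.cast_zero, zero_mul, mul_zero,
      sub_zero] at this
    refine this.of_forall_eq fun k => ?_
    simp only [Nat.add_sub_cancel]
    push_cast
    ring
  have hl := ((h1.add s2.hasSum).add h3).of_forall_eq fun k =>
    show laguerreTau v k * w k = _ by rw [laguerreTau_apply]; ring
  have hr := ((s3.hasSum.add s2.hasSum).add s1.hasSum).of_forall_eq fun k =>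
    show v k * laguerreTau w k = _ by rw [laguerreTau_apply]; ring
  rw [hl.tsum_eq, hr.tsum_eq]
  ring

/-! ### The parameter `b` as a function of time. -/

/-- The number `1 / (1 + it)`, which is the `(0, 0)` entry of `exp(-itH₀)`. -/
noncomputable def laguerreParam (t : ℝ) : ℂ := 1 / (1 + t * Complex.I)

namespace laguerreParam

theorem one_add_ne_zero (t : ℝ) : (1 : ℂ) + t * Complex.I ≠ 0 := fun h => by
  simpa using congrArg Complex.re h

theorem zero : laguerreParam 0 = 1 := by simp [laguerreParam]

theorem conj (t : ℝ) : (starRingEnd ℂ) (laguerreParam t) = laguerreParam (-t) := by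
  simp [laguerreParam]

theorem norm_eq (t : ℝ) : ‖laguerreParam t‖ = 1 / Real.sqrt (1 + t ^ 2) := by
  have h := Complex.norm_add_mul_I 1 t
  rw [Complex.ofReal_one, one_pow] at h
  rw [laguerreParam, norm_div, norm_one, h]

theorem norm_sub_one_lt (t : ℝ) : ‖laguerreParam t - 1‖ < 1 := by
  have h0 := one_add_ne_zero t
  have h1 : laguerreParam t - 1 = -(t * Complex.I) / (1 + t * Complex.I) := by
    rw [laguerreParam]; field_simp; ring
  have h := Complex.norm_add_mul_I 1 t
  rw [Complex.ofReal_one, one_pow] at h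
  rw [h1, norm_div, div_lt_one (norm_pos_iff.2 h0), h]
  simp only [norm_neg, norm_mul, Complex.norm_I, mul_one, Complex.norm_real, Real.norm_eq_abs]
  rw [← Real.sqrt_sq_eq_abs]
  exact Real.sqrt_lt_sqrt (sq_nonneg t) (by linarith)

theorem hasDerivAt (t : ℝ) :
    HasDerivAt laguerreParam (-Complex.I * laguerreParam t ^ 2) t := by
  have h := (((Complex.ofRealCLM.hasDerivAt (x := t)).mul_const Complex.I).const_add 1).inv
    (one_add_ne_zero t)
  have h2 : laguerreParam = (fun x : ℝ => 1 + Complex.ofRealCLM x * Complex.I)⁻¹ := by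
    funext x; simp [laguerreParam]
  rw [h2]
  refine h.congr_deriv ?_
  simp [div_eq_mul_inv]

theorem one_sub_mul_ne_zero (s t : ℝ) : 1 - (laguerreParam s - 1) * (laguerreParam t - 1) ≠ 0 := by
  intro h
  have h1 : ‖(laguerreParam s - 1) * (laguerreParam t - 1)‖ < 1 := by
    rw [norm_mul]
    exact mul_lt_one_of_nonneg_of_lt_one_left (norm_nonneg _) (norm_sub_one_lt s)
      (norm_sub_one_lt t).le
  rw [← sub_eq_zero.1 h, norm_one] at h1
  exact lt_irrefl _ h1

theorem add_eq (s t : ℝ) : laguerreParam (s + t) =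
    laguerreParam s * laguerreParam t / (1 - (laguerreParam s - 1) * (laguerreParam t - 1)) := by
  rw [eq_div_iff (one_sub_mul_ne_zero s t)]
  have h1 := one_add_ne_zero s
  have h2 := one_add_ne_zero t
  have h3 := one_add_ne_zero (s + t)
  simp only [laguerreParam]
  push_cast at h3 ⊢
  field_simp
  ring

/-- With `add_eq`, this matches the closed form in `laguerreKernel.hasSum_mul_pow` at `c =
laguerreParam t - 1`. -/
theorem add_sub_one_eq (s t : ℝ) : laguerreParam (s + t) - 1 =
    laguerreParam s - 1 + laguerreParam s ^ 2 * (laguerreParam t - 1) /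
      (1 - (laguerreParam s - 1) * (laguerreParam t - 1)) := by
  rw [add_eq]
  field_simp [one_sub_mul_ne_zero s t]
  ring

end laguerreParam

/-! ### The group law for the kernel. -/

namespace laguerreKernel

theorem recurrence (b : ℂ) (m k : ℕ) : laguerreTau (laguerreKernel b m) k =
    m * laguerreKernel b (m - 1) k + (2 * m + 1) * laguerreKernel b m k
      + (m + 1) * laguerreKernel b (m + 1) k := by
  rw [laguerreTau_symm, laguerreTau_apply]

theorem summable_norm {b : ℂ} (h : ‖b - 1‖ < 1) (n : ℕ) :
    Summable fun k : ℕ => ‖laguerreKernel b n k‖ :=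
  Summable.of_nonneg_of_le (fun _ => norm_nonneg _)
    (fun k => le_mul_of_one_le_left (norm_nonneg _) (by simp)) (summable_weighted_norm h n)

theorem norm_le_tsum {b : ℂ} (h : ‖b - 1‖ < 1) (n k : ℕ) :
    ‖laguerreKernel b n k‖ ≤ ∑' i, ‖laguerreKernel b n i‖ :=
  (summable_norm h n).le_tsum k fun _ _ => norm_nonneg _

theorem summable_mul {b : ℂ} (h : ‖b - 1‖ < 1) (n : ℕ) {w : ℕ → ℂ} {C : ℝ}
    (hw : ∀ k, ‖w k‖ ≤ C) : Summable fun k => laguerreKernel b n k * w k := by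
  refine Summable.of_norm_bounded ((summable_norm h n).mul_right C) fun k => ?_
  rw [norm_mul]
  exact mul_le_mul_of_nonneg_left (hw k) (norm_nonneg _)

/-- Applying `τ` to a bounded sequence before pairing with the kernel is the same as applying it
to the free variable of the kernel. -/
theorem tsum_mul_laguerreTau {b : ℂ} (h : ‖b - 1‖ < 1) (n : ℕ) {w : ℕ → ℂ} {C : ℝ}
    (hw : ∀ k, ‖w k‖ ≤ C) : ∑' k, laguerreKernel b n k * laguerreTau w k =
      laguerreTau (fun i => ∑' k, laguerreKernel b i k * w k) n := by
  rw [← tsum_laguerreTau_mul (summable_weighted_norm h n) hw, laguerreTau_apply]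
  have hs := fun i => (summable_mul h i hw).hasSum
  refine HasSum.tsum_eq (HasSum.of_forall_eq ((((hs (n - 1)).mul_left (n : ℂ)).add
    ((hs n).mul_left (2 * n + 1 : ℂ))).add ((hs (n + 1)).mul_left (n + 1 : ℂ))) fun k => ?_)
  rw [recurrence]
  ring

/-- Read at column `m`, the symmetry relation expresses `(m + 1) * F n (m + 1)` through columns `m`
and `m - 1`, so column `0` determines all the others. -/
theorem eq_of_laguerreTau_symm {F G : ℕ → ℕ → ℂ}
    (hF : ∀ n m, laguerreTau (F n) m = laguerreTau (fun i => F i m) n)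
    (hG : ∀ n m, laguerreTau (G n) m = laguerreTau (fun i => G i m) n)
    (h : ∀ n, F n 0 = G n 0) (n m : ℕ) : F n m = G n m := by
  induction m using Nat.strong_induction_on generalizing n with
  | _ m ih =>
    cases m with
    | zero => exact h n
    | succ m =>
      have h1 := hF n m
      have h2 := hG n m
      rw [show (fun i => F i m) = fun i => G i m from funext fun i => ih m m.lt_succ_self i,
        ← h2, laguerreTau_apply, laguerreTau_apply, ih m m.lt_succ_self,
        ih (m - 1) (by omega)] at h1
      exact mul_left_cancel₀ (Nat.cast_add_one_ne_zero m) (add_left_cancel h1)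

theorem tsum_mul (s t : ℝ) (n m : ℕ) :
    ∑' k, laguerreKernel (laguerreParam s) n k * laguerreKernel (laguerreParam t) m k =
      laguerreKernel (laguerreParam (s + t)) n m := by
  have hs := laguerreParam.norm_sub_one_lt s
  have ht := laguerreParam.norm_sub_one_lt t
  refine eq_of_laguerreTau_symm (F := fun n m => ∑' k, laguerreKernel (laguerreParam s) n k *
    laguerreKernel (laguerreParam t) m k) (fun n m => ?_) (fun n m => laguerreTau_symm _ n m)
    (fun n => ?_) n m
  -- `τ` travels from the variable `n` to the summation index, across the product, and out to `m`.
  · rw [← tsum_mul_laguerreTau hs n (norm_le_tsum ht m),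
      ← tsum_laguerreTau_mul (summable_weighted_norm hs n) (norm_le_tsum ht m)]
    simp only [mul_comm (laguerreKernel (laguerreParam s) n _)]
    rw [← tsum_mul_laguerreTau ht m (norm_le_tsum hs n)]
    exact tsum_congr fun k => mul_comm _ _
  · have h1 : ‖(laguerreParam s - 1) * (laguerreParam t - 1)‖ < 1 := by
      rw [norm_mul]
      exact mul_lt_one_of_nonneg_of_lt_one_left (norm_nonneg _) hs ht.le
    have h2 := (hasSum_mul_pow h1 n).mul_left (laguerreParam t)
    rw [symm, zero_left, laguerreParam.add_sub_one_eq, laguerreParam.add_eq]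
    refine ((h2.of_forall_eq fun k => ?_).tsum_eq).trans ?_
    · rw [zero_left]; ring
    · ring

theorem hasDerivAt_param (t : ℝ) (n m : ℕ) :
    HasDerivAt (fun t => laguerreKernel (laguerreParam t) n m)
      (-Complex.I * laguerreTau (laguerreKernel (laguerreParam t) n) m) t := by
  obtain ⟨d, h1, h2⟩ := hasDerivAt (laguerreParam t) n m
  refine (h1.comp t (laguerreParam.hasDerivAt t)).congr_deriv ?_
  rw [← h2]
  ring

end laguerreKernel

/-! ### The sharp bound on the kernel entries. -/

open Polynomial in
theorem Polynomial.coeff_linear_pow (a b : ℂ) (n k : ℕ) :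
    ((C a * X + C b) ^ n).coeff k = n.choose k * a ^ k * b ^ (n - k) := by
  rw [add_pow, finsetSum_coeff]
  have h : ∀ i, ((C a * X) ^ i * C b ^ (n - i) * (n.choose i : ℂ[X])).coeff k =
      if k = i then n.choose i * a ^ i * b ^ (n - i) else 0 := fun i => by
    rw [show (C a * X) ^ i * C b ^ (n - i) * (n.choose i : ℂ[X]) =
      C (n.choose i * a ^ i * b ^ (n - i)) * X ^ i by simp only [map_mul, map_pow, map_natCast]; ring,
      coeff_C_mul_X_pow]
  simp only [h, Finset.sum_ite_eq, Finset.mem_range]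
  split_ifs with hk
  · rfl
  · rw [Nat.choose_eq_zero_of_lt (by omega)]; simp

open Polynomial in
/-- The diagonal matrix coefficients of the symmetric powers of a unitary `2 × 2` matrix are
bounded by `1`. -/
theorem norm_coeff_linear_pow_mul_le_one {a b : ℂ}
    (h1 : a * (starRingEnd ℂ) a + b * (starRingEnd ℂ) b = 1)
    (h2 : a * (starRingEnd ℂ) b + b * (starRingEnd ℂ) a = 0) (n m : ℕ) :
    ‖((C a * X + C b) ^ n * (C b * X + C a) ^ m).coeff n‖ ≤ 1 := by
  set P : ℕ → ℂ[X] := fun k => (C a * X + C b) ^ k * (C b * X + C a) ^ (n + m - k) with hP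
  set Q : ℕ → ℂ[X] := fun k => (P k).map (starRingEnd ℂ) with hQ
  -- Unitarity as an identity in two variables: `(aX + b)(āY + b̄) + (bX + a)(b̄Y + ā) = XY + 1`,
  -- raised to the power `n + m`. The coefficient of `X ^ n Y ^ n` gives a weighted sum of squares
  -- whose term `k = n` carries the same weight as the right side.
  have key : ∑ k ∈ Finset.range (n + m + 1), C (P k) * (Q k).map C * ((n + m).choose k : ℂ[X][X]) =
      (C X * X + C 1) ^ (n + m) := by
    have hl : (C X * X + C 1 : ℂ[X][X]) =
        C (C a * X + C b) * ((C a * X + C b).map (starRingEnd ℂ)).map C +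
          C (C b * X + C a) * ((C b * X + C a).map (starRingEnd ℂ)).map C := by
      have e1 := congrArg (fun z => (C (C z) : ℂ[X][X])) h1
      have e2 := congrArg (fun z => (C (C z) : ℂ[X][X])) h2
      simp only [map_add, map_mul, map_one, map_zero, Polynomial.map_add, Polynomial.map_mul,
        map_C, map_X] at e1 e2 ⊢
      linear_combination (-(C X * X + 1)) * e1 - (C X + X) * e2
    rw [hl, add_pow]
    refine Finset.sum_congr rfl fun k _ => ?_
    simp only [hP, hQ, map_mul, map_pow, Polynomial.map_mul, Polynomial.map_pow]
    ring
  have hc := congrArg (fun p : ℂ[X][X] => (p.coeff n).coeff n) key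
  have hr : (((C X * X + C 1 : ℂ[X][X]) ^ (n + m)).coeff n).coeff n = ((n + m).choose n : ℂ) := by
    rw [add_pow, finsetSum_coeff, Finset.sum_eq_single n]
    · rw [mul_pow, ← C_pow, C_1, one_pow, mul_one, mul_assoc, mul_comm (X ^ n), ← C_eq_natCast,
        ← mul_assoc, ← C_mul, coeff_C_mul_X_pow, if_pos rfl, mul_comm, ← C_eq_natCast,
        coeff_C_mul_X_pow, if_pos rfl]
    · intro i _ hi
      rw [mul_pow, ← C_pow, C_1, one_pow, mul_one, mul_assoc, mul_comm (X ^ i), ← C_eq_natCast,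
        ← mul_assoc, ← C_mul, coeff_C_mul_X_pow, if_neg hi.symm]
    · simp
  have hterm : ∀ k, ((C (P k) * (Q k).map C * ((n + m).choose k : ℂ[X][X])).coeff n).coeff n =
      (((n + m).choose k * ‖(P k).coeff n‖ ^ 2 : ℝ) : ℂ) := fun k => by
    rw [mul_comm, ← C_eq_natCast, ← mul_assoc, ← C_mul, coeff_C_mul, coeff_map, coeff_mul_C,
      ← C_eq_natCast, coeff_C_mul, hQ, coeff_map, mul_assoc, Complex.mul_conj,
      Complex.normSq_eq_norm_sq]
    push_cast
    rfl
  simp only [finsetSum_coeff, hterm, hr] at hc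
  have hc' : ∑ k ∈ Finset.range (n + m + 1), ((n + m).choose k * ‖(P k).coeff n‖ ^ 2 : ℝ) =
      (n + m).choose n := by
    exact_mod_cast hc
  have hle := Finset.single_le_sum (f := fun k => ((n + m).choose k * ‖(P k).coeff n‖ ^ 2 : ℝ))
    (fun k _ => by positivity) (Finset.mem_range.2 (show n < n + m + 1 by omega))
  rw [hc'] at hle
  have hpos : (0 : ℝ) < (n + m).choose n := by
    exact_mod_cast Nat.choose_pos (Nat.le_add_right n m)
  have hsq : ‖(P n).coeff n‖ ^ 2 ≤ 1 := le_of_mul_le_mul_left (by simpa using hle) hpos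
  simpa [hP] using (sq_le_one_iff₀ (norm_nonneg _)).1 hsq

namespace laguerreKernel

open Polynomial in
theorem eq_mul_coeff (b : ℂ) (n m : ℕ) : laguerreKernel b n m =
    b * ((C (b - 1) * X + C b) ^ n * (C b * X + C (b - 1)) ^ m).coeff n := by
  rw [mul_comm ((C (b - 1) * X + C b) ^ n), coeff_mul,
    Finset.Nat.sum_antidiagonal_eq_sum_range_succ_mk, Finset.mul_sum]
  refine Finset.sum_congr rfl fun j hj => ?_
  have hj : j ≤ n := Nat.lt_succ_iff.1 (Finset.mem_range.1 hj)
  simp only [coeff_linear_pow, chooseGeom, Nat.choose_symm hj, Nat.sub_sub_self hj]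
  ring

theorem norm_le (t : ℝ) (n m : ℕ) :
    ‖laguerreKernel (laguerreParam t) n m‖ ≤ 1 / Real.sqrt (1 + t ^ 2) := by
  rw [eq_mul_coeff, norm_mul, laguerreParam.norm_eq]
  refine mul_le_of_le_one_right (by positivity) (norm_coeff_linear_pow_mul_le_one ?_ ?_ n m)
  -- Both unitarity conditions amount to `b + b̄ = 2 b b̄`, which is the addition law at `t` and
  -- `-t`.
  all_goals
    have h := laguerreParam.add_eq t (-t)
    rw [eq_div_iff (laguerreParam.one_sub_mul_ne_zero t (-t)), add_neg_cancel,
      laguerreParam.zero] at h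
    rw [map_sub, map_one, laguerreParam.conj]
    linear_combination -h

end laguerreKernel

/-! ### Uniqueness of the evolution group. -/

namespace IsEvolutionGroup

variable {E : Type*} [NormedAddCommGroup E] [InnerProductSpace ℂ E] [CompleteSpace E]
  {A : E →ₗ.[ℂ] E} {U V : ℝ → E →L[ℂ] E}

theorem inner_map_map (hU : IsEvolutionGroup A U) (t : ℝ) (x y : E) :
    inner ℂ (U t x) (U t y) = inner ℂ x y :=
  ContinuousLinearMap.inner_map_map_of_mem_unitary (hU.unitary t) x y

theorem tendsto (hU : IsEvolutionGroup A U) (u : A.domain) :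
    Filter.Tendsto (fun t : ℝ => (Complex.I / (t : ℂ)) • (U t u - u)) (nhdsWithin 0 {0}ᶜ)
      (nhds (A u)) :=
  (hU.generator u (A u)).2 ⟨u.2, rfl⟩

theorem map_mem_domain (hU : IsEvolutionGroup A U) (t : ℝ) (u : A.domain) :
    ∃ h : U t u ∈ A.domain, A ⟨U t u, h⟩ = U t (A u) := by
  refine (hU.generator _ _).1 ((((U t).continuous.tendsto _).comp (hU.tendsto u)).congr fun h => ?_)
  have h1 : U h (U t u) = U t (U h u) := by
    rw [← mul_apply_eq_comp, ← mul_apply_eq_comp, ← hU.map_add,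
      ← hU.map_add, add_comm]
  simp [h1]

theorem hasDerivAt (hU : IsEvolutionGroup A U) (t : ℝ) (u : A.domain) :
    HasDerivAt (fun t => U t u) (-Complex.I • U t (A u)) t := by
  rw [hasDerivAt_iff_tendsto_slope_zero]
  have h1 := (((U t).continuous.tendsto _).comp (hU.tendsto u)).const_smul (-Complex.I)
  refine h1.congr fun h => ?_
  have h2 : U (t + h) u = U t (U h u) := by
    rw [hU.map_add, mul_apply_eq_comp]
  rw [h2, Function.comp_apply, ← map_sub, map_smul, smul_smul, ← Complex.coe_smul,
    Complex.ofReal_inv]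
  congr 1
  rw [neg_mul, ← mul_div_assoc, Complex.I_mul_I]
  ring

theorem symmetric (hU : IsEvolutionGroup A U) (x y : A.domain) :
    inner ℂ (A x) (y : E) = inner ℂ (x : E) (A y) := by
  have h := (hU.hasDerivAt 0 x).inner ℂ (hU.hasDerivAt 0 y)
  simp only [hU.inner_map_map, hU.map_zero, one_apply_eq_self, inner_smul_left,
    inner_smul_right] at h
  have h0 := h.unique (hasDerivAt_const (0 : ℝ) _)
  simp only [map_neg, Complex.conj_I] at h0
  refine mul_left_cancel₀ Complex.I_ne_zero ?_
  linear_combination h0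

/-- Both orbits stay in the domain, where symmetry of `A` makes the two terms of the derivative
cancel. -/
theorem inner_map_map_eq (hU : IsEvolutionGroup A U) (hV : IsEvolutionGroup A V) (t : ℝ)
    (x y : A.domain) : inner ℂ (U t x) (V t y) = inner ℂ (x : E) (y : E) := by
  have h : ∀ s, HasDerivAt (fun s => inner ℂ (U s x) (V s y)) 0 s := fun s => by
    refine ((hU.hasDerivAt s x).inner ℂ (hV.hasDerivAt s y)).congr_deriv ?_
    obtain ⟨h1, h2⟩ := hU.map_mem_domain s x
    obtain ⟨h3, h4⟩ := hV.map_mem_domain s y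
    have h5 := hU.symmetric ⟨_, h1⟩ ⟨_, h3⟩
    rw [h2, h4] at h5
    simp only [inner_smul_left, inner_smul_right, map_neg, Complex.conj_I]
    rw [h5]
    ring
  have h1 := is_const_of_deriv_eq_zero (fun s => (h s).differentiableAt) (fun s => (h s).deriv) t 0
  simpa [hU.map_zero, hV.map_zero] using h1

/-- A densely defined operator generates at most one evolution group. -/
theorem unique (hU : IsEvolutionGroup A U) (hV : IsEvolutionGroup A V)
    (hA : Dense (A.domain : Set E)) : V = U := by
  funext t
  refine ContinuousLinearMap.coeFn_injective ?_
  refine Continuous.ext_on hA (V t).continuous (U t).continuous fun y hy => ?_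
  have h1 : inner ℂ (V t y - U t y) (V t y - U t y) = 0 := by
    have e1 := hV.inner_map_map t y y
    have e2 := hU.inner_map_map t y y
    have e3 := hU.inner_map_map_eq hV t ⟨y, hy⟩ ⟨y, hy⟩
    have e4 := hV.inner_map_map_eq hU t ⟨y, hy⟩ ⟨y, hy⟩
    simp only at e3 e4
    rw [inner_sub_sub_self, e1, e2, e3, e4]
    ring
  exact sub_eq_zero.1 (inner_self_eq_zero.1 h1)

end IsEvolutionGroup

/-! ### Differentiability of curves in `ℓ²`, and the kernel rows. -/

theorem tendsto_I_div_smul_iff_hasDerivAt {E : Type*} [NormedAddCommGroup E] [NormedSpace ℂ E] (g : ℝ → E) (f : E) :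
    Filter.Tendsto (fun t : ℝ => (Complex.I / (t : ℂ)) • (g t - g 0)) (nhdsWithin 0 {0}ᶜ) (nhds f)
      ↔ HasDerivAt g (-Complex.I • f) 0 := by
  rw [hasDerivAt_iff_tendsto_slope_zero]
  have e : ∀ t : ℝ, (Complex.I / (t : ℂ)) • (g t - g 0) =
      Complex.I • (t⁻¹ • (g (0 + t) - g 0)) := fun t => by
    rw [zero_add, ← Complex.coe_smul, smul_smul, Complex.ofReal_inv, div_eq_mul_inv]
  simp only [e]
  constructor
  · intro h
    simpa [smul_smul] using h.const_smul (-Complex.I)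
  · intro h
    simpa [smul_smul] using h.const_smul Complex.I

/-- A curve in `ℓ²` whose coordinates have derivatives that form a continuous curve in `ℓ²` is
differentiable. -/
theorem SeqLp.hasDerivAt_of_coord {f c : ℝ → SeqLp 2} (hc : Continuous c)
    (h : ∀ k t, HasDerivAt (fun t => f t k) (c t k) t) (t : ℝ) : HasDerivAt f (c t) t := by
  -- Coordinate evaluation commutes with the integral, so the fundamental theorem can be checked in
  -- each coordinate.
  have hf : f = fun t => f 0 + ∫ s in (0 : ℝ)..t, c s := by
    funext t
    ext k
    have h1 := (lp.evalCLM ℂ (fun _ : ℕ => ℂ) 2 k).intervalIntegral_comp_comm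
      (hc.intervalIntegrable (μ := MeasureTheory.volume) 0 t)
    have h2 : ∫ s in (0 : ℝ)..t, c s k = f t k - f 0 k :=
      intervalIntegral.integral_eq_sub_of_hasDerivAt (fun s _ => h k s)
        (((lp.evalCLM ℂ (fun _ : ℕ => ℂ) 2 k).continuous.comp hc).intervalIntegrable 0 t)
    have h3 : (∫ s in (0 : ℝ)..t, c s) k = f t k - f 0 k := h1.symm.trans h2
    rw [lp.coeFn_add, Pi.add_apply, h3]
    ring
  rw [hf]
  exact (intervalIntegral.integral_hasDerivAt_right (hc.intervalIntegrable 0 t)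
    (hc.stronglyMeasurableAtFilter _ _) hc.continuousAt).const_add (f 0)

/-- The rows of the kernel of `exp(-itH₀)`, as elements of `ℓ²`. -/
noncomputable def laguerreRow (t : ℝ) (n : ℕ) : SeqLp 2 :=
  ⟨laguerreKernel (laguerreParam t) n, by
    have h : Memℓp (laguerreKernel (laguerreParam t) n) 1 := memℓp_gen (by
      simpa using laguerreKernel.summable_norm (laguerreParam.norm_sub_one_lt t) n)
    exact h.of_exponent_ge one_le_two⟩

namespace laguerreRow

theorem apply (t : ℝ) (n k : ℕ) :
    laguerreRow t n k = laguerreKernel (laguerreParam t) n k := rfl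

theorem inner_left (t : ℝ) (n : ℕ) (u : SeqLp 2) :
    inner ℂ (laguerreRow t n) u = ∑' k, laguerreKernel (laguerreParam (-t)) n k * u k := by
  rw [lp.inner_eq_tsum]
  refine tsum_congr fun k => ?_
  rw [RCLike.inner_apply, apply, laguerreKernel.conj, laguerreParam.conj, mul_comm]

theorem inner_eq (s t : ℝ) (n m : ℕ) : inner ℂ (laguerreRow s n) (laguerreRow t m) =
    laguerreKernel (laguerreParam (t - s)) n m := by
  rw [inner_left]
  exact (laguerreKernel.tsum_mul (-s) t n m).trans (by rw [neg_add_eq_sub])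

theorem orthonormal (t : ℝ) : Orthonormal ℂ (laguerreRow t) := by
  rw [orthonormal_iff_ite]
  intro n m
  rw [inner_eq, sub_self, laguerreParam.zero, laguerreKernel.one]

theorem zero_eq_single (n : ℕ) : laguerreRow 0 n = lp.single 2 n 1 := by
  ext k
  rw [apply, laguerreParam.zero, laguerreKernel.one, lp.single_apply, Pi.single_apply]
  simp only [eq_comm]

theorem continuous (n : ℕ) : Continuous fun t => laguerreRow t n := by
  rw [continuous_iff_continuousAt]
  intro s
  rw [ContinuousAt, tendsto_iff_norm_sub_tendsto_zero]
  -- For unit vectors the distance depends only on the inner product, here a single kernel entry.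
  have h : ∀ t, ‖laguerreRow t n - laguerreRow s n‖ =
      Real.sqrt (2 - 2 * (laguerreKernel (laguerreParam (s - t)) n n).re) := fun t => by
    rw [← Real.sqrt_sq (norm_nonneg (laguerreRow t n - laguerreRow s n)),
      norm_sub_sq (𝕜 := ℂ), (orthonormal t).1, (orthonormal s).1, inner_eq]
    congr 1
    simp only [RCLike.re_to_complex]
    ring
  have hc : Continuous fun t => laguerreKernel (laguerreParam t) n n :=
    continuous_iff_continuousAt.2 fun t => (laguerreKernel.hasDerivAt_param t n n).continuousAt
  have hc' : Continuous fun t =>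
      Real.sqrt (2 - 2 * (laguerreKernel (laguerreParam (s - t)) n n).re) :=
    Real.continuous_sqrt.comp (continuous_const.sub (continuous_const.mul
      (Complex.continuous_re.comp (hc.comp (continuous_const.sub continuous_id)))))
  simp only [h]
  refine (hc'.tendsto s).trans_eq ?_
  simp [laguerreParam.zero, laguerreKernel.one]

theorem hasDerivAt (t : ℝ) (n : ℕ) : HasDerivAt (fun t => laguerreRow t n)
    (-Complex.I • ((n : ℂ) • laguerreRow t (n - 1) + (2 * n + 1 : ℂ) • laguerreRow t n
      + (n + 1 : ℂ) • laguerreRow t (n + 1))) t := by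
  refine SeqLp.hasDerivAt_of_coord (c := fun t => -Complex.I • ((n : ℂ) • laguerreRow t (n - 1)
    + (2 * n + 1 : ℂ) • laguerreRow t n + (n + 1 : ℂ) • laguerreRow t (n + 1))) ?_
    (fun k t => ?_) t
  · have h := continuous
    fun_prop
  · refine (laguerreKernel.hasDerivAt_param t n k).congr_deriv ?_
    rw [laguerreKernel.recurrence]
    rfl

end laguerreRow

/-! ### The unitary group, its generator and its norm. -/

/-- The unitary group `exp(-itH₀)`. -/
noncomputable def laguerreGroup (t : ℝ) : SeqLp 2 →L[ℂ] SeqLp 2 :=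
  (laguerreRow.orthonormal t).orthogonalFamily.linearIsometry.toContinuousLinearMap

namespace laguerreGroup

theorem norm_map (t : ℝ) (u : SeqLp 2) : ‖laguerreGroup t u‖ = ‖u‖ :=
  (laguerreRow.orthonormal t).orthogonalFamily.linearIsometry.norm_map u

theorem map_single (t : ℝ) (n : ℕ) (c : ℂ) :
    laguerreGroup t (lp.single 2 n c) = c • laguerreRow t n := by
  refine ((laguerreRow.orthonormal t).orthogonalFamily.linearIsometry_apply_single c).trans ?_
  rw [LinearIsometry.toSpanSingleton_apply]

theorem hasSum_apply (t : ℝ) (u : SeqLp 2) (n : ℕ) :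
    HasSum (fun k => laguerreKernel (laguerreParam t) n k * u k) (laguerreGroup t u n) := by
  have h := ((laguerreRow.orthonormal t).orthogonalFamily.hasSum_linearIsometry u).mapL
    (lp.evalCLM ℂ (fun _ : ℕ => ℂ) 2 n)
  refine h.of_forall_eq fun k => ?_
  rw [laguerreKernel.symm]
  exact mul_comm _ _

theorem apply_eq_tsum (t : ℝ) (u : SeqLp 2) (n : ℕ) :
    laguerreGroup t u n = ∑' k, laguerreKernel (laguerreParam t) n k * u k :=
  (hasSum_apply t u n).tsum_eq.symm

theorem apply_eq_inner (t : ℝ) (u : SeqLp 2) (n : ℕ) :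
    laguerreGroup t u n = inner ℂ (laguerreRow (-t) n) u := by
  rw [laguerreRow.inner_left, neg_neg, apply_eq_tsum]

theorem ext_single {f g : SeqLp 2 →L[ℂ] SeqLp 2}
    (h : ∀ n, f (lp.single 2 n 1) = g (lp.single 2 n 1)) : f = g := by
  refine lp.ext_continuousLinearMap ENNReal.ofNat_ne_top fun n => ?_
  ext1
  simpa using h n

theorem zero : laguerreGroup 0 = 1 := by
  refine ext_single fun n => ?_
  rw [map_single, one_smul, laguerreRow.zero_eq_single]
  rfl

theorem add (s t : ℝ) : laguerreGroup (s + t) = laguerreGroup s * laguerreGroup t := by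
  refine ext_single fun m => ?_
  rw [mul_apply_eq_comp, map_single, map_single, one_smul, one_smul]
  ext n
  rw [apply_eq_tsum, laguerreRow.apply, laguerreKernel.symm]
  exact (laguerreKernel.tsum_mul s t n m).symm

theorem mem_unitary (t : ℝ) : laguerreGroup t ∈ unitary (SeqLp 2 →L[ℂ] SeqLp 2) := by
  have h1 : star (laguerreGroup t) * laguerreGroup t = 1 :=
    (ContinuousLinearMap.norm_map_iff_adjoint_comp_self _).1 (norm_map t)
  have h2 : laguerreGroup t * laguerreGroup (-t) = 1 := by
    rw [← add, add_neg_cancel, zero]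
  refine Unitary.mem_iff.2 ⟨h1, ?_⟩
  rw [left_inv_eq_right_inv h1 h2, h2]

theorem continuous (u : SeqLp 2) : Continuous fun t => laguerreGroup t u := by
  -- Since each operator is isometric, truncating `u` gives an error independent of `t`.
  have h : TendstoUniformly (fun (s : Finset ℕ) t =>
      laguerreGroup t (∑ k ∈ s, lp.single 2 k (u k))) (fun t => laguerreGroup t u) Filter.atTop := by
    rw [Metric.tendstoUniformly_iff]
    intro ε hε
    filter_upwards [Metric.tendsto_nhds.1 (lp.hasSum_single ENNReal.ofNat_ne_top u) ε hε] with s hs t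
    rw [dist_eq_norm, ← map_sub, norm_map, ← dist_eq_norm, dist_comm]
    exact hs
  refine h.continuous (Filter.Frequently.of_forall fun s => ?_)
  simp only [map_sum, map_single]
  exact continuous_finsetSum _ fun k _ => (laguerreRow.continuous k).fun_const_smul (u k)

/-- Valid for every `u` in `ℓ²`: the time dependence sits in the differentiable row paired with `u`.
Hence differentiability of the orbit at `0` forces `τ u` to be the limit, and so to lie in `ℓ²`. -/
theorem hasDerivAt_coord (u : SeqLp 2) (n : ℕ) (t : ℝ) :
    HasDerivAt (fun t => laguerreGroup t u n) (-Complex.I * laguerreTau (laguerreGroup t u) n) t := by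
  have h1 := ((laguerreRow.hasDerivAt (-t) n).scomp t (hasDerivAt_neg t)).inner ℂ
    (hasDerivAt_const t u)
  have h2 : (fun t => laguerreGroup t u n) = fun t => inner ℂ (laguerreRow (-t) n) u :=
    funext fun t => apply_eq_inner t u n
  rw [h2]
  refine h1.congr_deriv ?_
  rw [laguerreTau_apply]
  simp only [apply_eq_inner, inner_zero_right, zero_add, inner_smul_left, inner_add_left,
    neg_smul, one_smul, inner_neg_left, map_add, map_mul, map_one, Complex.conj_I,
    Complex.conj_natCast, Complex.conj_ofNat]
  ring

theorem laguerreTau_coord {u f : SeqLp 2} (h : laguerreTau u = f) (t : ℝ) (n : ℕ) :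
    laguerreTau (laguerreGroup t u) n = laguerreGroup t f n := by
  have h1 := laguerreKernel.tsum_mul_laguerreTau (laguerreParam.norm_sub_one_lt t) n
    (lp.norm_apply_le_norm two_ne_zero u)
  rw [h] at h1
  rw [apply_eq_tsum, h1]
  exact congrArg (laguerreTau · n) (funext fun i => apply_eq_tsum t u i)

theorem hasDerivAt {u f : SeqLp 2} (h : laguerreTau u = f) (t : ℝ) :
    HasDerivAt (fun t => laguerreGroup t u) (-Complex.I • laguerreGroup t f) t := by
  refine SeqLp.hasDerivAt_of_coord (c := fun t => -Complex.I • laguerreGroup t f)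
    ((continuous f).fun_const_smul _) (fun n t => ?_) t
  refine (hasDerivAt_coord u n t).congr_deriv ?_
  rw [laguerreTau_coord h]
  rfl

theorem isEvolutionGroup : IsEvolutionGroup laguerreOperator laguerreGroup where
  unitary := mem_unitary
  map_zero := zero
  map_add := add
  continuous := continuous
  generator u f := by
    have h0 : laguerreGroup 0 u = u := by rw [zero]; rfl
    have h1 := tendsto_I_div_smul_iff_hasDerivAt (fun t => laguerreGroup t u) f
    simp only [h0] at h1
    rw [h1]
    constructor
    · intro h
      have h2 : laguerreTau u = f := by
        funext n
        have h3 := ((lp.evalCLM ℂ (fun _ : ℕ => ℂ) 2 n).restrictScalars ℝ).hasFDerivAt.comp_hasDerivAt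
          (0 : ℝ) h
        have h4 := (hasDerivAt_coord u n 0).unique h3
        rw [h0] at h4
        exact mul_left_cancel₀ (neg_ne_zero.2 Complex.I_ne_zero) h4
      exact ⟨show Memℓp (laguerreTau u) 2 from h2 ▸ lp.memℓp f, lp.ext h2⟩
    · rintro ⟨hu, hf⟩
      have h2 : laguerreTau u = f := congrArg (fun v : SeqLp 2 => (v : ℕ → ℂ)) hf
      have h3 := hasDerivAt h2 0
      rwa [zero] at h3

theorem norm_asOneInfty (t : ℝ) : ‖asOneInfty (laguerreGroup t)‖ = 1 / Real.sqrt (1 + t ^ 2) := by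
  have happ : ∀ (u : SeqLp 1) (n : ℕ), asOneInfty (laguerreGroup t) u n =
      laguerreGroup t (inclOneTwo u) n := fun _ _ => rfl
  apply le_antisymm
  · refine ContinuousLinearMap.opNorm_le_bound _ (by positivity) fun u => ?_
    refine lp.norm_le_of_forall_le (by positivity) fun n => ?_
    have hu : HasSum (fun k => ‖u k‖) ‖u‖ := by
      simpa using lp.hasSum_norm (p := 1) (by norm_num) u
    rw [happ, apply_eq_tsum]
    refine tsum_of_norm_bounded (hu.mul_left _) fun k => ?_
    rw [norm_mul]
    exact mul_le_mul_of_nonneg_right (laguerreKernel.norm_le t n k) (norm_nonneg _)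
  · have h1 := (asOneInfty (laguerreGroup t)).le_opNorm (lp.single 1 0 1)
    rw [lp.norm_single one_pos, norm_one, mul_one] at h1
    refine le_trans (le_of_eq ?_) ((lp.norm_apply_le_norm ENNReal.top_ne_zero _ 0).trans h1)
    have h2 : inclOneTwo (lp.single 1 0 1) = lp.single 2 0 1 := rfl
    rw [happ, h2, map_single, one_smul, laguerreRow.apply, laguerreKernel.zero_left, pow_zero,
      mul_one, laguerreParam.norm_eq]

end laguerreGroup

/-! ### Density of the domain and conclusion. -/

theorem dense_domain_laguerreOperator : Dense (laguerreOperator.domain : Set (SeqLp 2)) := by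
  intro u
  refine mem_closure_of_tendsto (lp.hasSum_single ENNReal.ofNat_ne_top u)
    (Filter.Eventually.of_forall fun s => sum_mem fun k _ => ?_)
  have h : laguerreRow 0 k ∈ laguerreOperator.domain := by
    have h1 : laguerreTau (laguerreRow 0 k) = ((k : ℂ) • laguerreRow 0 (k - 1)
        + (2 * k + 1 : ℂ) • laguerreRow 0 k + (k + 1 : ℂ) • laguerreRow 0 (k + 1) : SeqLp 2) :=
      funext fun n => laguerreKernel.recurrence _ k n
    exact show Memℓp (laguerreTau (laguerreRow 0 k)) 2 from h1 ▸ lp.memℓp _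
  have h2 : (lp.single 2 k (u k) : SeqLp 2) = u k • laguerreRow 0 k := by
    rw [laguerreRow.zero_eq_single, ← lp.single_smul, smul_eq_mul, mul_one]
  rw [h2]
  exact Submodule.smul_mem _ _ h

theorem theorem1 :
    ∃ U : ℝ → SeqLp 2 →L[ℂ] SeqLp 2,
      IsEvolutionGroup laguerreOperator U ∧
      (∀ V : ℝ → SeqLp 2 →L[ℂ] SeqLp 2, IsEvolutionGroup laguerreOperator V → V = U) ∧
      ∀ t : ℝ, ‖asOneInfty (U t)‖ = 1 / Real.sqrt (1 + t ^ 2) :=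
  ⟨laguerreGroup, laguerreGroup.isEvolutionGroup,
    fun _ hV => laguerreGroup.isEvolutionGroup.unique hV dense_domain_laguerreOperator,
    laguerreGroup.norm_asOneInfty⟩
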